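/- Let $X$ be an infinite-dimensional real Hilbert space. For a convex continuous function $f\colon X\to\mathbb{R}$ with $C_f=\{x\in X: f(x)\le 0\}\neq\varnothing$ and a selection $s$ of its subdifferential (i.e. $s(x)\in\partial f(x)$ for all $x\in X$), the associated subgradient projector $G=G_{f,s}\colon X\to X$ is defined by $$Gx = x-\frac{f(x)}{\|s(x)\|^2}\,s(x)\ \text{ if } f(x)>0,\qquad Gx=x\ \text{ otherwise.}$$ Call $b\colon X\to\mathbb{R}$ a Borwein–Fabian function if $b$ is continuous and convex with $\min b(X)=b(0)=0$, $b$ is Fréchet differentiable on $X\smallsetminus\{0\}$, and at $0$ it is Gâteaux differentiable with $\nabla b(0)=0$ but not Fréchet differentiable. Then the following hold. 1. A Borwein–Fabian function exists on $X$. 2. Let $b$ be any Borwein–Fabian function on $X$. Then there exists $y\in X$ such that $\nabla b(y)\neq 0$. For every such $y$, define $$f(x)=b(x)-\langle\nabla b(y),x\rangle-\tfrac12\big(b(y)-\langle\nabla b(y),y\rangle\big)\qquad(x\in X).$$ Then $f$ is convex and continuous, $C_f\neq\varnothing$, $\partial f$ admits a selection, and for every selection $s$ of $\partial f$ with associated subgradient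 projector $G$: (i) $f$ is Gâteaux differentiable but not Fréchet differentiable at $0$, and $G$ is not strong-to-weak continuous at $0$; (ii) $f$ is Fréchet differentiable on $X\smallsetminus\{0\}$, and $G$ is (strong-to-strong) continuous at every point of $X\smallsetminus\{0\}$. 3. Consequently, on $X$ it is not true that for all convex continuous $f\colon X\to\mathbb{R}$ with $C_f\neq\varnothing$ and all selections $s$ of $\partial f$, the operator $G_{f,s}$ is strong-to-weak continuous on $X$ if and only if $f$ is Gâteaux differentiable on $X\smallsetminus C_f$. -/

import Mathlib

open scoped RealInnerProductSpace

noncomputable section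

namespace SubgradProj

variable {X : Type*} [NormedAddCommGroup X] [InnerProductSpace ℝ X]

/-- `f` is Gâteaux differentiable at `x` with Gâteaux gradient `u`: the directional derivative of
`f` at `x` exists in every direction `h` and equals `⟪u, h⟫`. -/
def HasGateauxGradientAt (f : X → ℝ) (u x : X) : Prop :=
  ∀ h : X, HasLineDerivAt ℝ f ⟪u, h⟫ x h

/-- Gâteaux differentiability at a point. In a Hilbert space the continuous linear functionals
are the maps `⟪u, ·⟫`. -/
def GateauxDifferentiableAt (f : X → ℝ) (x : X) : Prop :=
  ∃ u : X, HasGateauxGradientAt f u x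

/-- The subdifferential `∂f(x)` of convex analysis. -/
def subdifferential (f : X → ℝ) (x : X) : Set X :=
  {u | ∀ z : X, f x + ⟪u, z - x⟫ ≤ f z}

/-- `s` is a selection of `∂f`. -/
def IsSelection (f : X → ℝ) (s : X → X) : Prop :=
  ∀ x : X, s x ∈ subdifferential f x

/-- The sublevel set `C = {x | f x ≤ 0}`. -/
def sublevel (f : X → ℝ) : Set X :=
  {x | f x ≤ 0}

/-- The subgradient projector of `f` associated with the selection `s` of `∂f`. -/
def subgradientProjector (f : X → ℝ) (s : X → X) (x : X) : X :=
  if 0 < f x then x - (f x / ‖s x‖ ^ 2) • s x else x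

/-- Continuity at `x` from the norm topology to the weak topology. -/
def StrongToWeakContinuousAt (T : X → X) (x : X) : Prop :=
  ContinuousAt (fun z => toWeakSpace ℝ X (T z)) x

/-- The properties of the Borwein–Fabian function: continuous and convex with minimum value
`b 0 = 0`, Fréchet differentiable away from `0`, and at `0` Gâteaux differentiable with
gradient `0`, but not Fréchet differentiable. -/
structure IsBorweinFabian (b : X → ℝ) : Prop where
  continuous : Continuous b
  convex : ConvexOn ℝ Set.univ b
  map_zero : b 0 = 0
  nonneg : ∀ x : X, 0 ≤ b x
  differentiableAt : ∀ x : X, x ≠ 0 → DifferentiableAt ℝ b x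
  gateaux_zero : HasGateauxGradientAt b 0 0
  not_differentiableAt_zero : ¬ DifferentiableAt ℝ b 0

/-- The function `x ↦ b x - ⟪v, x⟫ - (b y - ⟪v, y⟫) / 2`, used with `v = ∇b(y)`. -/
def tilt (b : X → ℝ) (v y : X) (x : X) : ℝ :=
  b x - ⟪v, x⟫ - (1 / 2) * (b y - ⟪v, y⟫)

end SubgradProj

end

/-! The obstruction is the Kadec–Klee property. If f is Gâteaux differentiable at x with gradient u
≠ 0 and f(x) > 0, then s(z) → u weakly as z → x. Near x, ⟨u, z - Gz⟩ = f(z)⟨u, s(z)⟩ / ‖s(z)‖², so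
weak continuity of G forces ‖s(z)‖ → ‖u‖, hence s(z) → u in norm, and then f is Fréchet
differentiable at x. The tilt makes 0 such a point while keeping Fréchet differentiability there
false (`not_strongToWeakContinuousAt_tilt`). Away from 0, Fréchet differentiability makes s norm
continuous, and G inherits this because f takes a negative value.

For existence, take b(x) = (∑ φᵢ(xᵢ)²)^(1/2) in a Hilbert basis, where φᵢ is |·| smoothed at scale
εᵢ > 0 and inf εᵢ = 0. In a fixed direction the smoothing wins as t → 0, but b(2εᵢeᵢ) ≥ εᵢ excludes
uniformity over directions. -/

namespace SubgradProj

open Filter Topology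

/-! ### Subgradients and continuity of selections -/

section Subdifferential

variable {X : Type*} [NormedAddCommGroup X] [InnerProductSpace ℝ X] {f : X → ℝ}

/-- A Gâteaux gradient of a convex function is a subgradient. -/
theorem HasGateauxGradientAt.mem_subdifferential {u x : X} (h : HasGateauxGradientAt f u x)
    (hf : ConvexOn ℝ Set.univ f) : u ∈ subdifferential f x := by
  intro z
  have hline : ConvexOn ℝ Set.univ fun t : ℝ => f (x + t • (z - x)) := by
    refine ⟨convex_univ, fun r _ t _ a b ha hb hab => ?_⟩
    have key := hf.2 (Set.mem_univ (x + r • (z - x))) (Set.mem_univ (x + t • (z - x))) ha hb hab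
    have e : x + (a • r + b • t) • (z - x) = a • (x + r • (z - x)) + b • (x + t • (z - x)) := by
      have : x = (a + b) • x := by rw [hab, one_smul]
      nth_rewrite 1 [this]
      simp only [smul_eq_mul]
      module
    simp only [e]
    exact key
  have := hline.le_slope_of_hasDerivAt (Set.mem_univ 0) (Set.mem_univ 1) one_pos (h (z - x))
  simp [slope_def_field] at this
  linarith

/-- A subgradient agrees with any Gâteaux gradient. -/
theorem HasGateauxGradientAt.eq_of_mem_subdifferential {u w x : X}
    (h : HasGateauxGradientAt f w x) (hu : u ∈ subdifferential f x) : u = w := by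
  refine ext_inner_right ℝ fun d => ?_
  have hd : HasDerivAt (fun t : ℝ => f (x + t • d) - t * ⟪u, d⟫) (⟪w, d⟫ - 1 * ⟪u, d⟫) 0 :=
    (h d).sub ((hasDerivAt_id (0 : ℝ)).mul_const _)
  have hmin : IsLocalMin (fun t : ℝ => f (x + t • d) - t * ⟪u, d⟫) 0 :=
    Eventually.of_forall fun t => by
      have := hu (x + t • d)
      simp [inner_smul_right] at this ⊢
      linarith
  linarith [hmin.hasDerivAt_eq_zero hd]

theorem HasGateauxGradientAt.of_hasFDerivAt {L : X →L[ℝ] ℝ} {u x : X} (h : HasFDerivAt f L x)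
    (hL : ∀ d, L d = ⟪u, d⟫) : HasGateauxGradientAt f u x := fun d => by
  rw [← hL]
  exact h.hasLineDerivAt d

theorem GateauxDifferentiableAt.of_differentiableAt [CompleteSpace X] {x : X}
    (h : DifferentiableAt ℝ f x) : GateauxDifferentiableAt f x :=
  ⟨(InnerProductSpace.toDual ℝ X).symm (fderiv ℝ f x),
    .of_hasFDerivAt h.hasFDerivAt fun d => by simp⟩

/-- A selection of the subdifferential of a continuous function that is Fréchet differentiable
at `x` is continuous at `x`. -/
theorem IsSelection.continuousAt [CompleteSpace X] {s : X → X} (hs : IsSelection f s)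
    (hf : Continuous f) {x : X} (hx : DifferentiableAt ℝ f x) : ContinuousAt s x := by
  set u := (InnerProductSpace.toDual ℝ X).symm (fderiv ℝ f x) with hu
  have hud : ∀ d, fderiv ℝ f x d = ⟪u, d⟫ := fun d => by simp [hu]
  have hsx : s x = u :=
    (HasGateauxGradientAt.of_hasFDerivAt hx.hasFDerivAt hud).eq_of_mem_subdifferential (hs x)
  rw [Metric.continuousAt_iff']
  intro ε hε
  have hlo := hx.hasFDerivAt.isLittleO.def (half_pos (half_pos hε))
  obtain ⟨δ, hδ, hball⟩ := Metric.eventually_nhds_iff.1 hlo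
  have hδ' : 0 < δ / 2 := half_pos hδ
  have hη : 0 < ε / 4 * (δ / 2) := by positivity
  -- Testing the subgradient at the reflected point 2z - x bounds ⟪s z, z - x⟫ by f(2z - x) - f z,
  -- so no local bound on `s` is needed.
  have hc : Tendsto (fun z => f x - f z + (f (z + (z - x)) - f z)) (𝓝 x) (𝓝 0) := by
    have : Continuous fun z => f x - f z + (f (z + (z - x)) - f z) := by fun_prop
    simpa using this.tendsto x
  filter_upwards [hc.eventually (gt_mem_nhds hη)] with z hz
  rw [hsx, dist_eq_norm]
  by_contra! hcon
  have hpos : 0 < ‖s z - u‖ := hε.trans_le hcon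
  set d := (δ / 2 / ‖s z - u‖) • (s z - u) with hd
  have hdn : ‖d‖ = δ / 2 := by
    rw [hd, norm_smul, Real.norm_of_nonneg (by positivity), div_mul_cancel₀ _ hpos.ne']
  have h1 := hball (y := x + d) (by simp [hdn]; linarith)
  rw [hud, add_sub_cancel_left, hdn, Real.norm_eq_abs] at h1
  have h1' := (abs_le.1 h1).2
  have h2 := hs z (x + d)
  have h3 := hs z (z + (z - x))
  rw [show x + d - z = d - (z - x) by abel, inner_sub_right] at h2
  rw [add_sub_cancel_left] at h3
  have h4 : ⟪s z - u, d⟫ = δ / 2 * ‖s z - u‖ := by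
    rw [hd, inner_smul_right, real_inner_self_eq_norm_sq]
    field_simp
  rw [inner_sub_left] at h4
  nlinarith

/-- Selections of the subdifferential of a continuous function converge weakly to the Gâteaux
gradient at points where it exists. -/
theorem HasGateauxGradientAt.tendsto_inner_of_isSelection {s : X → X} {u x : X}
    (h : HasGateauxGradientAt f u x) (hs : IsSelection f s) (hf : Continuous f) (d : X) :
    Tendsto (fun z => ⟪s z, d⟫) (𝓝 x) (𝓝 ⟪u, d⟫) := by
  -- A difference quotient at a fixed t > 0 bounds ⟪s z, d⟫ from above and is continuous in z. Lower
  -- bounds follow by replacing d with -d.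
  have upper : ∀ d : X, ∀ c, ⟪u, d⟫ < c → ∀ᶠ z in 𝓝 x, ⟪s z, d⟫ < c := by
    intro d c hc
    have hslope := (hasDerivAt_iff_tendsto_slope_zero.1 (h d)).mono_left
      (nhdsWithin_mono 0 fun t (ht : t ∈ Set.Ioi (0 : ℝ)) => ne_of_gt ht)
    obtain ⟨t, htc, ht⟩ := ((hslope.eventually (gt_mem_nhds hc)).and self_mem_nhdsWithin).exists
    have ht : 0 < t := ht
    have hcont : Continuous fun z => t⁻¹ * (f (z + t • d) - f z) := by fun_prop
    have hev := (hcont.tendsto x).eventually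
      (gt_mem_nhds (show t⁻¹ * (f (x + t • d) - f x) < c by simpa using htc))
    filter_upwards [hev] with z hz
    refine lt_of_le_of_lt ?_ hz
    have := hs z (z + t • d)
    rw [add_sub_cancel_left, inner_smul_right] at this
    rw [le_inv_mul_iff₀ ht]
    linarith
  rw [tendsto_order]
  refine ⟨fun c hc => ?_, fun c hc => upper d c hc⟩
  filter_upwards [upper (-d) (-c) (by simpa using hc)] with z hz
  simpa using hz

end Subdifferential

/-! ### Continuity of the subgradient projector -/

section Projector

variable {X : Type*} [NormedAddCommGroup X] [InnerProductSpace ℝ X] {f : X → ℝ} {s : X → X}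

theorem subgradientProjector_eq_max (f : X → ℝ) (s : X → X) (x : X) :
    subgradientProjector f s x = x - (max (f x) 0 / ‖s x‖ ^ 2) • s x := by
  unfold subgradientProjector
  split_ifs with h
  · rw [max_eq_left h.le]
  · simp [max_eq_right (not_lt.1 h)]

theorem StrongToWeakContinuousAt.tendsto_inner {T : X → X} {x : X}
    (h : StrongToWeakContinuousAt T x) (d : X) :
    Tendsto (fun z => ⟪d, T z⟫) (𝓝 x) (𝓝 ⟪d, T x⟫) :=
  ((WeakBilin.eval_continuous (topDualPairing ℝ X).flip (innerSL ℝ d)).tendsto _).comp h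

/-- The subgradient projector of a function taking a negative value is continuous wherever the
function is Fréchet differentiable. -/
theorem IsSelection.continuousAt_subgradientProjector [CompleteSpace X] (hs : IsSelection f s)
    (hf : Continuous f) {x y : X} (hx : DifferentiableAt ℝ f x) (hy : f y < 0) :
    ContinuousAt (subgradientProjector f s) x := by
  -- A zero subgradient makes x a minimizer, so f x ≤ f y < 0 and the projector is the identity near
  -- x.
  by_cases h0 : s x = 0
  · have hfx : f x < 0 := by
      have := hs x y
      rw [h0, inner_zero_left] at this
      linarith
    refine continuousAt_id.congr ?_
    filter_upwards [hf.continuousAt.eventually (gt_mem_nhds hfx)] with z hz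
    simp [subgradientProjector, hz.not_gt]
  · have hsc := hs.continuousAt hf hx
    rw [funext (subgradientProjector_eq_max f s)]
    refine continuousAt_id.sub (ContinuousAt.smul (ContinuousAt.div ?_ ?_ ?_) hsc)
    · exact (hf.max continuous_const).continuousAt
    · exact hsc.norm.pow 2
    · simpa using h0

/-- If `f` is Gâteaux differentiable at `x` with `0 < f x` and the subgradient projector is
strong-to-weak continuous at `x`, then the selection is norm continuous at `x`. -/
theorem IsSelection.tendsto_of_strongToWeakContinuousAt (hs : IsSelection f s)
    (hf : Continuous f) {u x : X} (hu : HasGateauxGradientAt f u x) (hfx : 0 < f x) (hu0 : u ≠ 0)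
    (hG : StrongToWeakContinuousAt (subgradientProjector f s) x) :
    Tendsto s (𝓝 x) (𝓝 u) := by
  have hsx : s x = u := hu.eq_of_mem_subdifferential (hs x)
  have hn : 0 < ‖u‖ ^ 2 := by positivity
  have hsu := hu.tendsto_inner_of_isSelection hs hf u
  rw [real_inner_self_eq_norm_sq] at hsu
  have hGu := hG.tendsto_inner u
  have hid : Tendsto (fun z : X => ⟪u, z⟫) (𝓝 x) (𝓝 ⟪u, x⟫) :=
    (by fun_prop : Continuous fun z : X => ⟪u, z⟫).tendsto x
  have hval : ⟪u, x⟫ - ⟪u, subgradientProjector f s x⟫ = f x := by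
    rw [subgradientProjector, if_pos hfx, inner_sub_right, inner_smul_right, hsx,
      real_inner_self_eq_norm_sq]
    field_simp
    ring
  have hdiff := hid.sub hGu
  rw [hval] at hdiff
  have hsq : Tendsto (fun z => ‖s z‖ ^ 2) (𝓝 x) (𝓝 (‖u‖ ^ 2)) := by
    have hlim := ((hf.tendsto x).mul hsu).div hdiff hfx.ne'
    rw [mul_div_cancel_left₀ _ hfx.ne'] at hlim
    refine hlim.congr' ?_
    filter_upwards [hf.continuousAt.eventually (lt_mem_nhds hfx),
      hsu.eventually (lt_mem_nhds hn)] with z hz hzu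
    have hsz : s z ≠ 0 := by
      rintro h
      simp [h] at hzu
    have hsz' : 0 < ‖s z‖ := by positivity
    simp only [Pi.div_apply]
    rw [subgradientProjector, if_pos hz, inner_sub_right, inner_smul_right,
      real_inner_comm (s z) u, sub_sub_cancel]
    field_simp
  -- Weak convergence together with convergence of norms gives norm convergence.
  have hzero : Tendsto (fun z => ‖s z - u‖ ^ 2) (𝓝 x) (𝓝 0) := by
    have := (hsq.sub (hsu.const_mul 2)).add_const (‖u‖ ^ 2)
    rw [show ‖u‖ ^ 2 - 2 * ‖u‖ ^ 2 + ‖u‖ ^ 2 = 0 by ring] at this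
    simpa only [norm_sub_sq_real] using this
  rw [tendsto_iff_norm_sub_tendsto_zero]
  simpa [Real.sqrt_sq] using hzero.sqrt

/-- A function with a selection of its subdifferential that is continuous at `x` is Fréchet
differentiable at `x`. -/
theorem IsSelection.differentiableAt (hs : IsSelection f s) {x : X} (h : ContinuousAt s x) :
    DifferentiableAt ℝ f x := by
  refine HasFDerivAt.differentiableAt (f' := innerSL ℝ (s x)) ?_
  rw [hasFDerivAt_iff_isLittleO, Asymptotics.isLittleO_iff]
  intro c hc
  filter_upwards [Metric.continuousAt_iff'.1 h c hc] with z hz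
  -- The two subgradient inequalities give 0 ≤ f z - f x - ⟪s x, z - x⟫ ≤ ⟪s z - s x, z - x⟫.
  have h1 := hs x z
  have h2 := hs z x
  have h3 : ⟪s z - s x, z - x⟫ ≤ ‖s z - s x‖ * ‖z - x‖ := real_inner_le_norm _ _
  have h4 : ‖s z - s x‖ * ‖z - x‖ ≤ c * ‖z - x‖ := by
    rw [dist_eq_norm] at hz
    gcongr
  rw [← neg_sub z x, inner_neg_right] at h2
  rw [inner_sub_left] at h3
  rw [innerSL_apply_apply, Real.norm_of_nonneg (by linarith)]
  linarith

end Projector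

/-! ### Tilting by a linear functional -/

section Tilt

variable {X : Type*} [NormedAddCommGroup X] [InnerProductSpace ℝ X] {b : X → ℝ} {v y : X}

theorem tilt_continuous (hb : Continuous b) : Continuous (tilt b v y) := by
  unfold tilt
  fun_prop

theorem tilt_convexOn (hb : ConvexOn ℝ Set.univ b) : ConvexOn ℝ Set.univ (tilt b v y) := by
  refine ⟨convex_univ, fun p _ q _ r t hr ht hrt => ?_⟩
  have := hb.2 (Set.mem_univ p) (Set.mem_univ q) hr ht hrt
  simp only [tilt, inner_add_right, inner_smul_right, smul_eq_mul] at this ⊢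
  set c := (1 / 2) * (b y - ⟪v, y⟫)
  have e : r * c + t * c = c := by rw [← add_mul, hrt, one_mul]
  linarith

theorem tilt_differentiableAt_iff {x : X} :
    DifferentiableAt ℝ (tilt b v y) x ↔ DifferentiableAt ℝ b x := by
  have hl : DifferentiableAt ℝ (fun x : X => ⟪v, x⟫ + (1 / 2) * (b y - ⟪v, y⟫)) x :=
    (innerSL ℝ v).differentiableAt.add_const _
  constructor
  · intro h
    convert! h.add hl using 1
    ext z
    simp [tilt]
  · intro h
    convert! h.sub hl using 1
    ext z
    simp [tilt]
    ring

theorem HasGateauxGradientAt.tilt {u x : X} (h : HasGateauxGradientAt b u x) :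
    HasGateauxGradientAt (tilt b v y) (u - v) x := by
  intro d
  have h1 : HasDerivAt (fun t : ℝ => ⟪v, x + t • d⟫) ⟪v, d⟫ 0 := by
    have : HasDerivAt (fun t : ℝ => ⟪v, x⟫ + t * ⟪v, d⟫) (1 * ⟪v, d⟫) 0 :=
      ((hasDerivAt_id (0 : ℝ)).mul_const _).const_add _
    simpa [inner_add_right, inner_smul_right] using this
  rw [inner_sub_left]
  exact ((h d).sub h1).sub_const _

end Tilt

/-! ### The tilted Borwein–Fabian function -/

namespace IsBorweinFabian

variable {X : Type*} [NormedAddCommGroup X] [InnerProductSpace ℝ X] {b : X → ℝ} {v y : X}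

theorem gateauxDifferentiableAt [CompleteSpace X] (hb : IsBorweinFabian b) (x : X) :
    GateauxDifferentiableAt b x := by
  by_cases hx : x = 0
  · exact hx ▸ ⟨0, hb.gateaux_zero⟩
  · exact .of_differentiableAt (hb.differentiableAt x hx)

theorem exists_gradient_ne_zero [CompleteSpace X] (hb : IsBorweinFabian b) :
    ∃ y v : X, HasGateauxGradientAt b v y ∧ v ≠ 0 := by
  by_contra! h
  refine hb.not_differentiableAt_zero ?_
  have hzero : b = fun _ => 0 := by
    ext x
    obtain ⟨v, hv⟩ := hb.gateauxDifferentiableAt x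
    have := hv.mem_subdifferential hb.convex 0
    rw [h x v hv, inner_zero_left, hb.map_zero] at this
    linarith [hb.nonneg x]
  rw [hzero]
  exact differentiableAt_const _

/-- The tangent of `b` at a point with nonzero gradient is negative at `0`. -/
theorem lt_inner_gradient (hb : IsBorweinFabian b) (hv : HasGateauxGradientAt b v y)
    (hv0 : v ≠ 0) : b y < ⟪v, y⟫ := by
  have hsub := hv.mem_subdifferential hb.convex
  have h0 := hsub 0
  rw [hb.map_zero, zero_sub, inner_neg_right] at h0
  -- Equality would make v a subgradient at 0, where the only one is 0.
  refine lt_of_le_of_ne (by linarith) fun heq => hv0 ?_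
  refine hb.gateaux_zero.eq_of_mem_subdifferential fun z => ?_
  have := hsub z
  rw [inner_sub_right] at this
  rw [hb.map_zero, sub_zero]
  linarith

/-- The factor 1/2 in `tilt` makes the values at 0 and y opposite, so the strict tangent inequality
settles both signs. -/
theorem tilt_zero_pos (hb : IsBorweinFabian b) (hv : HasGateauxGradientAt b v y)
    (hv0 : v ≠ 0) : 0 < tilt b v y 0 := by
  have := hb.lt_inner_gradient hv hv0
  simp only [tilt, hb.map_zero, inner_zero_right]
  linarith

theorem tilt_self_neg (hb : IsBorweinFabian b) (hv : HasGateauxGradientAt b v y)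
    (hv0 : v ≠ 0) : tilt b v y y < 0 := by
  have := hb.lt_inner_gradient hv hv0
  simp only [tilt]
  linarith

theorem tilt_gateauxDifferentiableAt [CompleteSpace X] (hb : IsBorweinFabian b) (v y x : X) :
    GateauxDifferentiableAt (tilt b v y) x :=
  (hb.gateauxDifferentiableAt x).imp' (· - v) fun _ h => h.tilt

theorem exists_isSelection_tilt [CompleteSpace X] (hb : IsBorweinFabian b) (v y : X) :
    ∃ s : X → X, IsSelection (tilt b v y) s := by
  choose s hs using hb.tilt_gateauxDifferentiableAt v y
  exact ⟨s, fun x => (hs x).mem_subdifferential (tilt_convexOn hb.convex)⟩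

theorem not_strongToWeakContinuousAt_tilt (hb : IsBorweinFabian b)
    (hv : HasGateauxGradientAt b v y) (hv0 : v ≠ 0) {s : X → X}
    (hs : IsSelection (tilt b v y) s) :
    ¬ StrongToWeakContinuousAt (subgradientProjector (tilt b v y) s) 0 := by
  intro hG
  have hgrad : HasGateauxGradientAt (tilt b v y) (0 - v) 0 := hb.gateaux_zero.tilt
  have hlim := hs.tendsto_of_strongToWeakContinuousAt (tilt_continuous hb.continuous) hgrad
    (hb.tilt_zero_pos hv hv0) (by simpa using hv0) hG
  refine hb.not_differentiableAt_zero ((tilt_differentiableAt_iff (v := v) (y := y)).1 ?_)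
  refine hs.differentiableAt ?_
  rw [ContinuousAt, hgrad.eq_of_mem_subdifferential (hs 0)]
  exact hlim

end IsBorweinFabian

/-! ### One-dimensional estimates for the smoothed absolute value -/

/-- The convex function `t ↦ √(t² + ε²) - ε`, a `C^∞` approximation of `|t|`. -/
noncomputable def softAbs (ε t : ℝ) : ℝ := √(t ^ 2 + ε ^ 2) - ε

section SoftAbs

variable {ε : ℝ}

theorem softAbs_zero (hε : 0 < ε) : softAbs ε 0 = 0 := by
  simp [softAbs, Real.sqrt_sq hε.le]

theorem softAbs_nonneg (ε t : ℝ) : 0 ≤ softAbs ε t :=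
  sub_nonneg.2 (Real.le_sqrt_of_sq_le (by nlinarith [sq_nonneg t]))

theorem softAbs_pos (ε : ℝ) {t : ℝ} (ht : t ≠ 0) : 0 < softAbs ε t :=
  sub_pos.2 (Real.lt_sqrt_of_sq_lt (by linarith [sq_pos_of_ne_zero ht]))

theorem softAbs_le_abs (hε : 0 < ε) (t : ℝ) : softAbs ε t ≤ |t| := by
  have : √(t ^ 2 + ε ^ 2) ≤ |t| + ε :=
    Real.sqrt_le_iff.2 ⟨by positivity, by nlinarith [sq_abs t, abs_nonneg t]⟩
  unfold softAbs
  linarith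

theorem softAbs_le_sq_div (hε : 0 < ε) (t : ℝ) : softAbs ε t ≤ t ^ 2 / (2 * ε) := by
  have : √(t ^ 2 + ε ^ 2) ≤ t ^ 2 / (2 * ε) + ε := by
    refine Real.sqrt_le_iff.2 ⟨by positivity, ?_⟩
    have : (t ^ 2 / (2 * ε) + ε) ^ 2 = (t ^ 2 / (2 * ε)) ^ 2 + t ^ 2 + ε ^ 2 := by
      field_simp
      ring
    nlinarith [sq_nonneg (t ^ 2 / (2 * ε))]
  unfold softAbs
  linarith

theorem softAbs_sq_le (hε : 0 < ε) (t : ℝ) : softAbs ε t ^ 2 ≤ t ^ 2 := by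
  rw [← sq_abs t]
  exact pow_le_pow_left₀ (softAbs_nonneg ε t) (softAbs_le_abs hε t) 2

theorem le_softAbs_two_mul (ε : ℝ) : ε ≤ softAbs ε (2 * ε) := by
  have : 2 * ε ≤ √((2 * ε) ^ 2 + ε ^ 2) := Real.le_sqrt_of_sq_le (by nlinarith)
  unfold softAbs
  linarith

/-- √(t² + ε²) is the Euclidean norm of (t, ε); `h3` is Cauchy–Schwarz in the plane. -/
theorem softAbs_combo_le (ε : ℝ) {p q r t : ℝ} (hr : 0 ≤ r) (ht : 0 ≤ t) (hrt : r + t = 1) :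
    softAbs ε (r * p + t * q) ≤ r * softAbs ε p + t * softAbs ε q := by
  have h1 := Real.sq_sqrt (show 0 ≤ p ^ 2 + ε ^ 2 by positivity)
  have h2 := Real.sq_sqrt (show 0 ≤ q ^ 2 + ε ^ 2 by positivity)
  have h3 : p * q + ε ^ 2 ≤ √(p ^ 2 + ε ^ 2) * √(q ^ 2 + ε ^ 2) := by
    rw [← Real.sqrt_mul (by positivity)]
    exact Real.le_sqrt_of_sq_le (by nlinarith [sq_nonneg (ε * (p - q))])
  have key : √((r * p + t * q) ^ 2 + ε ^ 2) ≤ r * √(p ^ 2 + ε ^ 2) + t * √(q ^ 2 + ε ^ 2) := by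
    refine Real.sqrt_le_iff.2 ⟨by positivity, ?_⟩
    have e : ε ^ 2 = (r + t) ^ 2 * ε ^ 2 := by rw [hrt]; ring
    have h4 := mul_le_mul_of_nonneg_left h3 (mul_nonneg hr ht)
    calc (r * p + t * q) ^ 2 + ε ^ 2
        = r ^ 2 * (p ^ 2 + ε ^ 2) + t ^ 2 * (q ^ 2 + ε ^ 2) + 2 * (r * t * (p * q + ε ^ 2)) := by
          rw [e]; simp only [hrt]; linear_combination (-(ε ^ 2) * (r + t + 1)) * hrt
      _ ≤ r ^ 2 * √(p ^ 2 + ε ^ 2) ^ 2 + t ^ 2 * √(q ^ 2 + ε ^ 2) ^ 2 +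
          2 * (r * t * (√(p ^ 2 + ε ^ 2) * √(q ^ 2 + ε ^ 2))) := by rw [h1, h2]; linarith
      _ = _ := by ring
  have : ε = r * ε + t * ε := by rw [← add_mul, hrt, one_mul]
  unfold softAbs
  linarith

/-- The derivative of `softAbs ε ^ 2`. -/
noncomputable def softSqDeriv (ε t : ℝ) : ℝ := 2 * t * (1 - ε / √(t ^ 2 + ε ^ 2))

theorem softSqDeriv_sq_le (hε : 0 < ε) (t : ℝ) : softSqDeriv ε t ^ 2 ≤ 4 * t ^ 2 := by
  have hS : ε ≤ √(t ^ 2 + ε ^ 2) := Real.le_sqrt_of_sq_le (by nlinarith [sq_nonneg t])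
  have h1 : ε / √(t ^ 2 + ε ^ 2) ≤ 1 := div_le_one_of_le₀ hS (Real.sqrt_nonneg _)
  have h0 : 0 ≤ ε / √(t ^ 2 + ε ^ 2) := by positivity
  have h2 : (1 - ε / √(t ^ 2 + ε ^ 2)) ^ 2 ≤ 1 := by nlinarith
  unfold softSqDeriv
  nlinarith [mul_le_mul_of_nonneg_left h2 (sq_nonneg (2 * t))]

/-- The bound does not depend on ε, so summing over coordinates leaves a remainder of at most ‖d‖².
-/
theorem abs_softAbs_sq_sub_le (hε : 0 < ε) (t d : ℝ) :
    |softAbs ε (t + d) ^ 2 - softAbs ε t ^ 2 - softSqDeriv ε t * d| ≤ d ^ 2 := by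
  set S := √(t ^ 2 + ε ^ 2) with hS
  set S' := √((t + d) ^ 2 + ε ^ 2) with hS'
  have hSε : ε ≤ S := Real.le_sqrt_of_sq_le (by nlinarith [sq_nonneg t])
  have hS0 : 0 < S := hε.trans_le hSε
  have hSS : S ^ 2 = t ^ 2 + ε ^ 2 := Real.sq_sqrt (by positivity)
  have hSS' : S' ^ 2 = (t + d) ^ 2 + ε ^ 2 := Real.sq_sqrt (by positivity)
  have hS'0 : 0 ≤ S' := Real.sqrt_nonneg _
  have hlow : t * (t + d) + ε ^ 2 ≤ S * S' := by
    rw [hS, hS', ← Real.sqrt_mul (by positivity)]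
    exact Real.le_sqrt_of_sq_le (by nlinarith [sq_nonneg (ε * d)])
  have e : softAbs ε (t + d) ^ 2 - softAbs ε t ^ 2 - softSqDeriv ε t * d
      = d ^ 2 - 2 * ε / S * (S * S' - (t * (t + d) + ε ^ 2)) := by
    simp only [softAbs, softSqDeriv, ← hS, ← hS']
    field_simp
    linear_combination S * hSS' + (2 * ε - S) * hSS
  have hup : 2 * (S * S' - (t * (t + d) + ε ^ 2)) ≤ d ^ 2 := by
    nlinarith [sq_nonneg (S - S')]
  have hq : 0 ≤ ε / S ∧ ε / S ≤ 1 := ⟨by positivity, div_le_one_of_le₀ hSε hS0.le⟩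
  have e2 : 2 * ε / S * (S * S' - (t * (t + d) + ε ^ 2)) =
      ε / S * (2 * (S * S' - (t * (t + d) + ε ^ 2))) := by ring
  have hb0 : 0 ≤ ε / S * (2 * (S * S' - (t * (t + d) + ε ^ 2))) :=
    mul_nonneg hq.1 (by linarith)
  have hb1 : ε / S * (2 * (S * S' - (t * (t + d) + ε ^ 2))) ≤ 1 * d ^ 2 :=
    mul_le_mul hq.2 hup (by linarith) zero_le_one
  rw [e, e2, abs_le]
  constructor <;> nlinarith [sq_nonneg d]

end SoftAbs

/-! ### Construction of a Borwein–Fabian function -/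

section Construction

variable {X : Type*} [NormedAddCommGroup X] [InnerProductSpace ℝ X] {ι : Type*}
  (B : HilbertBasis ι ℝ X) (ε : ι → ℝ)

/-- The sum of the squares of the smoothed absolute values of the coordinates. -/
noncomputable def softEnergy (x : X) : ℝ := ∑' i, softAbs (ε i) ⟪B i, x⟫ ^ 2

/-- The `ℓ²` norm of the smoothed absolute values of the coordinates. -/
noncomputable def softNorm (x : X) : ℝ := √(softEnergy B ε x)

theorem hasSum_inner_sq (x : X) : HasSum (fun i => ⟪B i, x⟫ ^ 2) (‖x‖ ^ 2) := by
  have := B.hasSum_inner_mul_inner x x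
  rw [real_inner_self_eq_norm_sq] at this
  convert! this using 2 with i
  rw [real_inner_comm x (B i), sq]

variable {ε}

theorem summable_softAbs_sq (hε : ∀ i, 0 < ε i) (x : X) :
    Summable fun i => softAbs (ε i) ⟪B i, x⟫ ^ 2 :=
  (hasSum_inner_sq B x).summable.of_nonneg_of_le (fun _ => sq_nonneg _)
    fun i => softAbs_sq_le (hε i) _

theorem softEnergy_zero (hε : ∀ i, 0 < ε i) : softEnergy B ε 0 = 0 := by
  simp [softEnergy, softAbs_zero (hε _)]

theorem softNorm_zero (hε : ∀ i, 0 < ε i) : softNorm B ε 0 = 0 := by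
  simp [softNorm, softEnergy_zero B hε]

theorem softAbs_le_softNorm (hε : ∀ i, 0 < ε i) (x : X) (i : ι) :
    softAbs (ε i) ⟪B i, x⟫ ≤ softNorm B ε x :=
  Real.le_sqrt_of_sq_le ((summable_softAbs_sq B hε x).le_tsum i fun _ _ => sq_nonneg _)

theorem softEnergy_pos (hε : ∀ i, 0 < ε i) {x : X} (hx : x ≠ 0) : 0 < softEnergy B ε x := by
  have : ∃ i, ⟪B i, x⟫ ≠ 0 := by
    by_contra! h
    have := (hasSum_inner_sq B x).tsum_eq
    simp only [h] at this
    simp at this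
    exact hx (norm_eq_zero.1 (pow_eq_zero_iff two_ne_zero |>.1 this.symm))
  obtain ⟨i, hi⟩ := this
  exact Real.sqrt_pos.1 ((softAbs_pos (ε i) hi).trans_le (softAbs_le_softNorm B hε x i))

/-- Each coordinate derivative is at most 2|⟪B i, x⟫| in absolute value, so they form an ℓ² sequence
and hence a vector. -/
theorem exists_gradient_softEnergy (hε : ∀ i, 0 < ε i) (x : X) :
    ∃ D : X, ∀ d, HasSum (fun i => softSqDeriv (ε i) ⟪B i, x⟫ * ⟪B i, d⟫) ⟪D, d⟫ := by
  have hmem : Memℓp (fun i => softSqDeriv (ε i) ⟪B i, x⟫) 2 := by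
    refine memℓp_gen ?_
    simp only [ENNReal.toReal_ofNat, Real.rpow_ofNat, Real.norm_eq_abs, sq_abs]
    exact ((hasSum_inner_sq B x).summable.mul_left 4).of_nonneg_of_le (fun _ => sq_nonneg _)
      fun i => softSqDeriv_sq_le (hε i) _
  let g : lp (fun _ : ι => ℝ) 2 := ⟨_, hmem⟩
  refine ⟨B.repr.symm g, fun d => ?_⟩
  have hg : ∀ i, ⟪B.repr.symm g, B i⟫ = softSqDeriv (ε i) ⟪B i, x⟫ := fun i => by
    rw [real_inner_comm, ← B.repr_apply_apply, LinearIsometryEquiv.apply_symm_apply]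
  simpa only [hg] using B.hasSum_inner_mul_inner (B.repr.symm g) d

theorem differentiable_softEnergy (hε : ∀ i, 0 < ε i) : Differentiable ℝ (softEnergy B ε) := by
  intro x
  obtain ⟨D, hD⟩ := exists_gradient_softEnergy B hε x
  refine HasFDerivAt.differentiableAt (f' := innerSL ℝ D) ?_
  rw [hasFDerivAt_iff_isLittleO_nhds_zero]
  refine Asymptotics.IsBigO.trans_isLittleO (g := fun d : X => ‖d‖ ^ 2) ?_
    (Asymptotics.isLittleO_norm_pow_id one_lt_two)
  refine Asymptotics.IsBigO.of_bound 1 (Eventually.of_forall fun d => ?_)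
  have hsum := ((summable_softAbs_sq B hε (x + d)).hasSum.sub
    (summable_softAbs_sq B hε x).hasSum).sub (hD d)
  have hbound : ∀ i, ‖softAbs (ε i) ⟪B i, x + d⟫ ^ 2 - softAbs (ε i) ⟪B i, x⟫ ^ 2 -
      softSqDeriv (ε i) ⟪B i, x⟫ * ⟪B i, d⟫‖ ≤ ⟪B i, d⟫ ^ 2 := fun i => by
    rw [inner_add_right]
    exact abs_softAbs_sq_sub_le (hε i) _ _
  rw [one_mul, norm_pow, norm_norm, innerSL_apply_apply]
  have := tsum_of_norm_bounded (hasSum_inner_sq B d) hbound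
  rwa [hsum.tsum_eq] at this

theorem continuous_softNorm (hε : ∀ i, 0 < ε i) : Continuous (softNorm B ε) :=
  (differentiable_softEnergy B hε).continuous.sqrt

theorem convexOn_softNorm (hε : ∀ i, 0 < ε i) : ConvexOn ℝ Set.univ (softNorm B ε) := by
  refine ⟨convex_univ, fun x _ y _ r t hr ht hrt => ?_⟩
  have hx := (summable_softAbs_sq B hε x).mul_left (r ^ 2)
  have hy := (summable_softAbs_sq B hε y).mul_left (t ^ 2)
  simp only [← mul_pow] at hx hy
  -- Minkowski in ℓ², combined with coordinatewise convexity of `softAbs`.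
  have mink := Real.Lp_add_le_tsum_of_nonneg one_le_two
    (fun i => mul_nonneg hr (softAbs_nonneg (ε i) ⟪B i, x⟫))
    (fun i => mul_nonneg ht (softAbs_nonneg (ε i) ⟪B i, y⟫))
    (by simpa only [Real.rpow_two] using hx) (by simpa only [Real.rpow_two] using hy)
  simp only [Real.rpow_two, ← Real.sqrt_eq_rpow] at mink
  have scale : ∀ c : ℝ, 0 ≤ c → ∀ z : X,
      √(∑' i, (c * softAbs (ε i) ⟪B i, z⟫) ^ 2) = c * softNorm B ε z := by
    intro c hc z
    simp only [mul_pow, tsum_mul_left]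
    rw [Real.sqrt_mul (sq_nonneg c), Real.sqrt_sq hc]
    rfl
  rw [scale r hr, scale t ht] at mink
  refine le_trans (Real.sqrt_le_sqrt ?_) mink.2
  refine (summable_softAbs_sq B hε _).tsum_le_tsum (fun i => ?_) mink.1
  refine pow_le_pow_left₀ (softAbs_nonneg (ε i) _) ?_ 2
  rw [inner_add_right, inner_smul_right, inner_smul_right]
  exact softAbs_combo_le _ hr ht hrt

/-- Dominated convergence for the squared quotients: each is O(t²) by `softAbs_le_sq_div`, and ⟪B i,
d⟫² dominates. -/
theorem hasGateauxGradientAt_softNorm_zero (hε : ∀ i, 0 < ε i) :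
    HasGateauxGradientAt (softNorm B ε) 0 0 := by
  intro d
  rw [inner_zero_left, HasLineDerivAt, hasDerivAt_iff_tendsto_slope_zero]
  have hlim : Tendsto (fun t : ℝ => ∑' i, (t⁻¹ * softAbs (ε i) (t * ⟪B i, d⟫)) ^ 2)
      (𝓝[≠] 0) (𝓝 (∑' _ : ι, 0)) := by
    have habs : ∀ t : ℝ, t ≠ 0 → ∀ i,
        (t⁻¹ * softAbs (ε i) (t * ⟪B i, d⟫)) ^ 2 ≤ ⟪B i, d⟫ ^ 2 := by
      intro t ht i
      have := softAbs_sq_le (hε i) (t * ⟪B i, d⟫)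
      rw [mul_pow, inv_pow, inv_mul_le_iff₀ (by positivity)]
      linarith [mul_pow t ⟪B i, d⟫ 2]
    refine tendsto_tsum_of_dominated_convergence (bound := fun i => ⟪B i, d⟫ ^ 2)
      (hasSum_inner_sq B d).summable (fun i => ?_) ?_
    · have hc : Tendsto (fun t : ℝ => t ^ 2 * (⟪B i, d⟫ ^ 2 / (2 * ε i)) ^ 2) (𝓝[≠] 0) (𝓝 0) := by
        have : Continuous fun t : ℝ => t ^ 2 * (⟪B i, d⟫ ^ 2 / (2 * ε i)) ^ 2 := by fun_prop
        simpa using (this.tendsto 0).mono_left nhdsWithin_le_nhds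
      refine squeeze_zero' (Eventually.of_forall fun t => sq_nonneg _) ?_ hc
      filter_upwards [self_mem_nhdsWithin] with t ht
      have ht : t ≠ 0 := ht
      have h1 := pow_le_pow_left₀ (softAbs_nonneg (ε i) _)
        (softAbs_le_sq_div (hε i) (t * ⟪B i, d⟫)) 2
      rw [mul_pow, inv_pow, inv_mul_le_iff₀ (by positivity)]
      refine h1.trans_eq ?_
      ring
    · filter_upwards [self_mem_nhdsWithin] with t ht i
      rw [Real.norm_of_nonneg (sq_nonneg _)]
      exact habs t ht i
  rw [tsum_zero] at hlim
  have hroot := hlim.sqrt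
  rw [Real.sqrt_zero] at hroot
  refine squeeze_zero_norm (fun t => le_of_eq ?_) hroot
  simp only [zero_add, zero_smul, softNorm_zero B hε, sub_zero, smul_eq_mul, mul_pow,
    tsum_mul_left]
  rw [Real.sqrt_mul (sq_nonneg _), Real.sqrt_sq_eq_abs, norm_mul, Real.norm_eq_abs,
    softNorm, Real.norm_of_nonneg (Real.sqrt_nonneg _)]
  simp only [softEnergy, inner_smul_right]

theorem not_differentiableAt_softNorm_zero (hε : ∀ i, 0 < ε i)
    (hsmall : ∀ δ > 0, ∃ i, ε i < δ) : ¬ DifferentiableAt ℝ (softNorm B ε) 0 := by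
  intro h
  have hzero : fderiv ℝ (softNorm B ε) 0 = 0 := by
    ext d
    rw [← h.lineDeriv_eq_fderiv, (hasGateauxGradientAt_softNorm_zero B hε d).lineDeriv]
    simp
  -- At 2εᵢeᵢ the quotient is at least 1/2, so any constant below 1/2 gives a contradiction.
  have hlo := h.hasFDerivAt.isLittleO.def (show (0 : ℝ) < 1 / 4 by norm_num)
  obtain ⟨δ, hδ, hball⟩ := Metric.eventually_nhds_iff.1 hlo
  obtain ⟨i, hi⟩ := hsmall (δ / 2) (half_pos hδ)
  have hBi : ‖B i‖ = 1 := B.orthonormal.1 i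
  have hnorm : ‖(2 * ε i) • B i‖ = 2 * ε i := by
    rw [norm_smul, hBi, mul_one, Real.norm_of_nonneg (by linarith [hε i])]
  have h1 := hball (y := (2 * ε i) • B i) (by rw [dist_zero_right, hnorm]; linarith)
  rw [hzero, softNorm_zero B hε, sub_zero, sub_zero, hnorm, zero_apply,
    sub_zero] at h1
  have h2 := softAbs_le_softNorm B hε ((2 * ε i) • B i) i
  rw [inner_smul_right, real_inner_self_eq_norm_sq, hBi, one_pow, mul_one] at h2
  linarith [le_of_abs_le h1, le_softAbs_two_mul (ε i), hε i]

theorem isBorweinFabian_softNorm (hε : ∀ i, 0 < ε i) (hsmall : ∀ δ > 0, ∃ i, ε i < δ) :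
    IsBorweinFabian (softNorm B ε) where
  continuous := continuous_softNorm B hε
  convex := convexOn_softNorm B hε
  map_zero := softNorm_zero B hε
  nonneg _ := Real.sqrt_nonneg _
  differentiableAt x hx := (differentiable_softEnergy B hε x).sqrt (softEnergy_pos B hε hx).ne'
  gateaux_zero := hasGateauxGradientAt_softNorm_zero B hε
  not_differentiableAt_zero := not_differentiableAt_softNorm_zero B hε hsmall

end Construction

theorem exists_pos_arbitrarily_small (ι : Type*) [Infinite ι] :
    ∃ ε : ι → ℝ, (∀ i, 0 < ε i) ∧ ∀ δ > 0, ∃ i, ε i < δ := by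
  let g := Infinite.natEmbedding ι
  -- The default value 1 keeps ε positive off the embedded sequence.
  refine ⟨Function.extend g (fun n : ℕ => 1 / ((n : ℝ) + 1)) 1, fun i => ?_, fun δ hδ => ?_⟩
  · by_cases h : ∃ n, g n = i
    · obtain ⟨n, rfl⟩ := h
      rw [g.injective.extend_apply]
      positivity
    · rw [Function.extend_apply' _ _ _ h]
      exact one_pos
  · obtain ⟨n, hn⟩ := exists_nat_one_div_lt hδ
    exact ⟨g n, by rwa [g.injective.extend_apply]⟩

theorem exists_isBorweinFabian (X : Type*) [NormedAddCommGroup X] [InnerProductSpace ℝ X]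
    [CompleteSpace X] (hX : ¬ FiniteDimensional ℝ X) : ∃ b : X → ℝ, IsBorweinFabian b := by
  obtain ⟨w, B, -⟩ := exists_hilbertBasis ℝ X
  have : Infinite w := by
    rw [← not_finite_iff_infinite]
    intro hfin
    have := Fintype.ofFinite w
    exact hX (Module.Finite.of_basis B.toOrthonormalBasis.toBasis)
  obtain ⟨ε, hε, hsmall⟩ := exists_pos_arbitrarily_small w
  exact ⟨_, isBorweinFabian_softNorm B hε hsmall⟩

end SubgradProj

theorem mainTheorem4 (X : Type*) [NormedAddCommGroup X] [InnerProductSpace ℝ X]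
    [CompleteSpace X] (hX : ¬ FiniteDimensional ℝ X) :
    (∃ b : X → ℝ, SubgradProj.IsBorweinFabian b) ∧
    (∀ b : X → ℝ, SubgradProj.IsBorweinFabian b →
      (∃ y v : X, SubgradProj.HasGateauxGradientAt b v y ∧ v ≠ 0) ∧
      ∀ y v : X, SubgradProj.HasGateauxGradientAt b v y → v ≠ 0 →
        ∀ f : X → ℝ, f = SubgradProj.tilt b v y →
          ConvexOn ℝ Set.univ f ∧ Continuous f ∧ (SubgradProj.sublevel f).Nonempty ∧
          (∃ s : X → X, SubgradProj.IsSelection f s) ∧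
          (SubgradProj.GateauxDifferentiableAt f 0 ∧ ¬ DifferentiableAt ℝ f 0 ∧
            ∀ s : X → X, SubgradProj.IsSelection f s →
              ¬ SubgradProj.StrongToWeakContinuousAt (SubgradProj.subgradientProjector f s) 0) ∧
          ((∀ x : X, x ≠ 0 → DifferentiableAt ℝ f x) ∧
            ∀ s : X → X, SubgradProj.IsSelection f s →
              ∀ x : X, x ≠ 0 → ContinuousAt (SubgradProj.subgradientProjector f s) x)) ∧
    ¬ (∀ (f : X → ℝ) (s : X → X), ConvexOn ℝ Set.univ f → Continuous f →
        (SubgradProj.sublevel f).Nonempty → SubgradProj.IsSelection f s →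
        ((∀ x : X, SubgradProj.StrongToWeakContinuousAt
            (SubgradProj.subgradientProjector f s) x) ↔
          ∀ x : X, x ∉ SubgradProj.sublevel f → SubgradProj.GateauxDifferentiableAt f x)) := by
  refine ⟨SubgradProj.exists_isBorweinFabian X hX,
    fun b hb => ⟨hb.exists_gradient_ne_zero, ?_⟩, fun hiff => ?_⟩
  · rintro y v hv hv0 f rfl
    have hcont := SubgradProj.tilt_continuous (v := v) (y := y) hb.continuous
    have hneg := hb.tilt_self_neg hv hv0
    have hdiff : ∀ x : X, x ≠ 0 → DifferentiableAt ℝ (SubgradProj.tilt b v y) x := fun x hx =>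
      SubgradProj.tilt_differentiableAt_iff.2 (hb.differentiableAt x hx)
    exact ⟨SubgradProj.tilt_convexOn hb.convex, hcont, ⟨y, hneg.le⟩,
      hb.exists_isSelection_tilt v y,
      ⟨hb.tilt_gateauxDifferentiableAt v y 0,
        fun h => hb.not_differentiableAt_zero (SubgradProj.tilt_differentiableAt_iff.1 h),
        fun s hs => hb.not_strongToWeakContinuousAt_tilt hv hv0 hs⟩,
      hdiff, fun s hs x hx => hs.continuousAt_subgradientProjector hcont (hdiff x hx) hneg⟩
  · obtain ⟨b, hb⟩ := SubgradProj.exists_isBorweinFabian X hX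
    obtain ⟨y, v, hv, hv0⟩ := hb.exists_gradient_ne_zero
    obtain ⟨s, hs⟩ := hb.exists_isSelection_tilt v y
    exact hb.not_strongToWeakContinuousAt_tilt hv hv0 hs
      ((hiff _ s (SubgradProj.tilt_convexOn hb.convex) (SubgradProj.tilt_continuous hb.continuous)
        ⟨y, (hb.tilt_self_neg hv hv0).le⟩ hs).2
          (fun x _ => hb.tilt_gateauxDifferentiableAt v y x) 0)
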